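/- Let $\mathfrak X,\mathfrak Y$ be Polish spaces, $\mu,\nu$ Borel probability measures on $\mathfrak X,\mathfrak Y$, $\Pi(\mu,\nu)$ the set of Borel probability measures on $\mathfrak X\times\mathfrak Y$ with marginals $\mu,\nu$, and $\pi_{\mathrm{ind}}=\mu\otimes\nu$. Let $c:(\mathfrak X\times\mathfrak Y)^2\to\mathbb R$ be jointly continuous, and suppose that there are continuous functions $c_X\in L^1(\mu)$, $c_Y\in L^1(\nu)$ with $$|c(x,y,x',y')|\le c_X(x)+c_Y(y)+c_X(x')+c_Y(y')\qquad\text{for all }x,x'\in\mathfrak X,\ y,y'\in\mathfrak Y.$$ A coupling in $\Pi(\mu,\nu)$ is called a minimizer (maximizer) if it minimizes (maximizes) the quadratic-form transport cost $$\pi\mapsto\iint c(x,y,x',y')\,\mathrm d\pi(x,y)\,\mathrm d\pi(x',y')$$ over $\pi\in\Pi(\mu,\nu)$. Put $$\tilde c(x,y)=\frac12\iint\big(c(x,y,x',y')+c(x',y',x,y)\big)\,\mathrm d\mu(x')\,\mathrm d\nu(y').$$ Then all these integrals converge absolutely (for every $\pi\in\Pi(\mu,\nu)$ and every $(x,y)$).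 Consider the statements (i) every $\pi\in\Pi(\mu,\nu)$ is a minimizer; (ii) $\pi_{\mathrm{ind}}$ is a minimizer or a maximizer; (iii) there exist functions $\varphi:\mathfrak X\to\mathbb R$ and $\psi:\mathfrak Y\to\mathbb R$ such that $\tilde c(x,y)=\varphi(x)+\psi(y)$ for $\pi_{\mathrm{ind}}$-a.e. $(x,y)$. Then (i) $\Rightarrow$ (ii) $\Rightarrow$ (iii). Moreover, suppose in addition that $c$ is bounded and, as a function of the pair $((x,y),(x',y'))$, symmetric and positive definite, i.e. $c(s,t)=c(t,s)$ and $\sum_{i,j=1}^n a_ia_j\,c(s_i,s_j)\ge0$ for all $n\in\mathbb N$, $s,t,s_1,\dots,s_n\in\mathfrak X\times\mathfrak Y$ and $a_1,\dots,a_n\in\mathbb R$. Then (iii) implies that $\pi_{\mathrm{ind}}$ is a minimizer, and hence (ii) and (iii) are equivalent. -/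

import Mathlib

open MeasureTheory

namespace QOT

/-- `Π(μ, ν)`: the set of all measures on `X × Y` with marginals `μ` and `ν`. -/
def couplings {X Y : Type*} [MeasurableSpace X] [MeasurableSpace Y]
    (μ : Measure X) (ν : Measure Y) : Set (Measure (X × Y)) :=
  {π | π.map Prod.fst = μ ∧ π.map Prod.snd = ν}

/-- The quadratic-form transport cost `∬ c dπ ⊗ dπ` (meaningful when `c` is integrable with
respect to `π ⊗ π`). -/
noncomputable def transportCost {X Y : Type*} [MeasurableSpace X] [MeasurableSpace Y]
    (c : (X × Y) × (X × Y) → ℝ) (π : Measure (X × Y)) : ℝ :=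
  ∫ z, c z ∂(π.prod π)

/-- `π` minimizes the quadratic-form transport cost over `Π(μ, ν)`. -/
def IsMinimizer {X Y : Type*} [MeasurableSpace X] [MeasurableSpace Y]
    (μ : Measure X) (ν : Measure Y) (c : (X × Y) × (X × Y) → ℝ) (π : Measure (X × Y)) : Prop :=
  π ∈ couplings μ ν ∧ ∀ π' ∈ couplings μ ν, transportCost c π ≤ transportCost c π'

/-- `π` maximizes the quadratic-form transport cost over `Π(μ, ν)`. -/
def IsMaximizer {X Y : Type*} [MeasurableSpace X] [MeasurableSpace Y]
    (μ : Measure X) (ν : Measure Y) (c : (X × Y) × (X × Y) → ℝ) (π : Measure (X × Y)) : Prop :=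
  π ∈ couplings μ ν ∧ ∀ π' ∈ couplings μ ν, transportCost c π' ≤ transportCost c π

/-- The symmetrized partial integral
`c̃(x, y) = (1/2) ∬ (c(x, y, x', y') + c(x', y', x, y)) dμ(x') dν(y')`. -/
noncomputable def symmPartialIntegral {X Y : Type*} [MeasurableSpace X] [MeasurableSpace Y]
    (μ : Measure X) (ν : Measure Y) (c : (X × Y) × (X × Y) → ℝ) (z : X × Y) : ℝ :=
  (1 / 2 : ℝ) * ∫ z', (c (z, z') + c (z', z)) ∂(μ.prod ν)

/-- `f(x, y) = φ(x) + ψ(y)` for `μ ⊗ ν`-almost every `(x, y)`, for some functions `φ`, `ψ`. -/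
def IsAESeparable {X Y : Type*} [MeasurableSpace X] [MeasurableSpace Y]
    (μ : Measure X) (ν : Measure Y) (f : X × Y → ℝ) : Prop :=
  ∃ (φ : X → ℝ) (ψ : Y → ℝ), ∀ᵐ z ∂(μ.prod ν), f z = φ z.1 + ψ z.2

/-- A symmetric function on `S × S` is positive definite if
`∑ i, ∑ j, a i * a j * k (s i, s j)` is nonnegative for all finite families of points `s i` in `S`
and of real coefficients `a i`. -/
def IsPositiveDefinite {S : Type*} (k : S × S → ℝ) : Prop :=
  (∀ s t, k (s, t) = k (t, s)) ∧
    ∀ (n : ℕ) (s : Fin n → S) (a : Fin n → ℝ), 0 ≤ ∑ i, ∑ j, a i * a j * k (s i, s j)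

end QOT

/-! For (i) ⇒ (ii), apply (i) to `μ.prod ν` itself.

For (ii) ⇒ (iii), perturb `μ ⊗ ν` inside the set of couplings by densities `1 + t g`, where `g` is
bounded with vanishing partial integrals. The cost is a quadratic polynomial in `t ∈ [-1, 1]`,
extremal at the interior point `t = 0`, so its linear coefficient `2 ∫ g c̃` vanishes
(`integral_add_mul_eq`). Being orthogonal to all such `g` forces `c̃` to be additively separable
(`isAESeparable_of_forall_integral_mul_eq_zero`).

For the converse, positive definiteness makes the quadratic form nonnegative on `π - μ ⊗ ν`
(`IsPositiveDefinite.integral_sub_nonneg`, by sampling). The cross terms sum to `2 ∫ c̃ dπ`, and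
separability with continuity makes this independent of `π`
(`IsAESeparable.integral_eq_of_mem_couplings`). Evaluating it at `μ ⊗ ν` shows that the cost of `π`
is at least that of `μ ⊗ ν`. -/

namespace QOT

/-! ### Couplings: integrability, perturbations, null open sets -/

section Couplings

variable {X Y : Type*} [MeasurableSpace X] [MeasurableSpace Y] {μ : Measure X} {ν : Measure Y}

lemma isProbabilityMeasure_of_mem_couplings [IsProbabilityMeasure μ] {π : Measure (X × Y)}
    (hπ : π ∈ couplings μ ν) : IsProbabilityMeasure π := by
  constructor
  have h := congrArg (fun m => m Set.univ) hπ.1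
  simpa [Measure.map_apply measurable_fst MeasurableSet.univ] using h

lemma prod_mem_couplings [IsProbabilityMeasure μ] [IsProbabilityMeasure ν] :
    μ.prod ν ∈ couplings μ ν := by
  constructor <;> simp

lemma integrable_comp_fst_of_mem_couplings {π : Measure (X × Y)} (hπ : π ∈ couplings μ ν)
    {f : X → ℝ} (hf : Integrable f μ) : Integrable (fun z => f z.1) π := by
  rw [← hπ.1] at hf
  exact hf.comp_measurable measurable_fst

lemma integrable_comp_snd_of_mem_couplings {π : Measure (X × Y)} (hπ : π ∈ couplings μ ν)
    {f : Y → ℝ} (hf : Integrable f ν) : Integrable (fun z => f z.2) π := by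
  rw [← hπ.2] at hf
  exact hf.comp_measurable measurable_snd

lemma integral_comp_fst_of_mem_couplings {π : Measure (X × Y)} (hπ : π ∈ couplings μ ν)
    {f : X → ℝ} (hf : AEStronglyMeasurable f μ) : ∫ z, f z.1 ∂π = ∫ x, f x ∂μ := by
  rw [← hπ.1] at hf ⊢
  rw [integral_map measurable_fst.aemeasurable hf]

lemma integral_comp_snd_of_mem_couplings {π : Measure (X × Y)} (hπ : π ∈ couplings μ ν)
    {f : Y → ℝ} (hf : AEStronglyMeasurable f ν) : ∫ z, f z.2 ∂π = ∫ y, f y ∂ν := by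
  rw [← hπ.2] at hf ⊢
  rw [integral_map measurable_snd.aemeasurable hf]

lemma integrable_prod_of_mem_couplings [IsProbabilityMeasure μ]
    {c : (X × Y) × (X × Y) → ℝ} (hc : Measurable c)
    {cX : X → ℝ} (hcX : Integrable cX μ) {cY : Y → ℝ} (hcY : Integrable cY ν)
    (hdom : ∀ x y x' y', |c ((x, y), (x', y'))| ≤ cX x + cY y + cX x' + cY y')
    {π ρ : Measure (X × Y)} (hπ : π ∈ couplings μ ν) (hρ : ρ ∈ couplings μ ν) :
    Integrable c (π.prod ρ) := by
  have := isProbabilityMeasure_of_mem_couplings hπ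
  have := isProbabilityMeasure_of_mem_couplings hρ
  refine Integrable.mono' (g := fun z => cX z.1.1 + cY z.1.2 + cX z.2.1 + cY z.2.2) ?_
    hc.aestronglyMeasurable (Filter.Eventually.of_forall fun z => hdom _ _ _ _)
  exact ((((integrable_comp_fst_of_mem_couplings hπ hcX).comp_fst ρ).add
    ((integrable_comp_snd_of_mem_couplings hπ hcY).comp_fst ρ)).add
    ((integrable_comp_fst_of_mem_couplings hρ hcX).comp_snd π)).add
    ((integrable_comp_snd_of_mem_couplings hρ hcY).comp_snd π)

lemma integrable_section_add_of_mem_couplings [IsProbabilityMeasure μ]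
    {c : (X × Y) × (X × Y) → ℝ} (hc : Measurable c)
    {cX : X → ℝ} (hcX : Integrable cX μ) {cY : Y → ℝ} (hcY : Integrable cY ν)
    (hdom : ∀ x y x' y', |c ((x, y), (x', y'))| ≤ cX x + cY y + cX x' + cY y')
    {π : Measure (X × Y)} (hπ : π ∈ couplings μ ν) (z : X × Y) :
    Integrable (fun z' => c (z, z') + c (z', z)) π := by
  have := isProbabilityMeasure_of_mem_couplings hπ
  have hX := integrable_comp_fst_of_mem_couplings hπ hcX
  have hY := integrable_comp_snd_of_mem_couplings hπ hcY
  refine Integrable.add ?_ ?_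
  · refine Integrable.mono' (((integrable_const (cX z.1 + cY z.2)).add hX).add hY)
      (hc.comp measurable_prodMk_left).aestronglyMeasurable
      (Filter.Eventually.of_forall fun z' => hdom _ _ _ _)
  · refine Integrable.mono' (((hX.add hY).add (integrable_const (cX z.1))).add
      (integrable_const (cY z.2))) (hc.comp measurable_prodMk_right).aestronglyMeasurable
      (Filter.Eventually.of_forall fun z' => hdom _ _ _ _)

/-- Reweighting `μ ⊗ ν` by a density `1 + g` with vanishing partial integrals of `g`
preserves the marginals. -/
lemma withDensity_mem_couplings [IsProbabilityMeasure μ] [IsProbabilityMeasure ν]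
    {g : X × Y → ℝ} (hg : Measurable g) (hg1 : ∀ z, |g z| ≤ 1)
    (hgX : ∀ x, ∫ y, g (x, y) ∂ν = 0) (hgY : ∀ y, ∫ x, g (x, y) ∂μ = 0) :
    (μ.prod ν).withDensity (fun z => ENNReal.ofReal (1 + g z)) ∈ couplings μ ν := by
  -- Nonnegativity ensures that `ENNReal.ofReal` truncates nothing.
  have hpos : ∀ z, 0 ≤ 1 + g z := fun z => by linarith [(abs_le.1 (hg1 z)).1]
  have hm : Measurable (fun z => ENNReal.ofReal (1 + g z)) := by fun_prop
  have hinnerX : ∀ x, ∫⁻ y, ENNReal.ofReal (1 + g (x, y)) ∂ν = 1 := fun x => by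
    have hi : Integrable (fun y => g (x, y)) ν :=
      Integrable.of_bound (hg.comp measurable_prodMk_left).aestronglyMeasurable 1
        (Filter.Eventually.of_forall fun y => hg1 _)
    rw [← ofReal_integral_eq_lintegral_ofReal (f := fun y => 1 + g (x, y))
      ((integrable_const 1).add hi) (Filter.Eventually.of_forall fun y => hpos _),
      integral_add (integrable_const _) hi, hgX]
    simp
  have hinnerY : ∀ y, ∫⁻ x, ENNReal.ofReal (1 + g (x, y)) ∂μ = 1 := fun y => by
    have hi : Integrable (fun x => g (x, y)) μ :=
      Integrable.of_bound (hg.comp measurable_prodMk_right).aestronglyMeasurable 1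
        (Filter.Eventually.of_forall fun y => hg1 _)
    rw [← ofReal_integral_eq_lintegral_ofReal (f := fun x => 1 + g (x, y))
      ((integrable_const 1).add hi) (Filter.Eventually.of_forall fun x => hpos _),
      integral_add (integrable_const _) hi, hgY]
    simp
  constructor
  · ext S hS
    rw [Measure.map_apply measurable_fst hS, withDensity_apply _ (measurable_fst hS),
      ← Set.prod_univ, ← Measure.prod_restrict, lintegral_prod _ hm.aemeasurable]
    simp [hinnerX]
  · ext S hS
    rw [Measure.map_apply measurable_snd hS, withDensity_apply _ (measurable_snd hS),
      ← Set.univ_prod, ← Measure.prod_restrict, lintegral_prod_symm _ hm.aemeasurable]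
    simp [hinnerY]

/-- An open set that is null for `μ ⊗ ν` is null for every coupling of `μ` and `ν`. -/
lemma measure_eq_zero_of_isOpen_of_mem_couplings
    [TopologicalSpace X] [SecondCountableTopology X] [OpensMeasurableSpace X]
    [TopologicalSpace Y] [SecondCountableTopology Y] [OpensMeasurableSpace Y] [SFinite ν]
    {O : Set (X × Y)} (hO : IsOpen O) (h0 : μ.prod ν O = 0)
    {π : Measure (X × Y)} (hπ : π ∈ couplings μ ν) : π O = 0 := by
  -- By second countability it suffices to work locally. A null open rectangle has a null side, and
  -- that side depends only on a marginal, which all couplings share.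
  refine measure_null_of_locally_null O fun z hz => ?_
  obtain ⟨U, V, hU, hV, hzU, hzV, hUV⟩ := isOpen_prod_iff.1 hO z.1 z.2 hz
  refine ⟨U ×ˢ V, mem_nhdsWithin_of_mem_nhds ((hU.prod hV).mem_nhds ⟨hzU, hzV⟩), ?_⟩
  have h := measure_mono_null hUV h0
  rw [Measure.prod_prod, mul_eq_zero] at h
  rcases h with h | h
  · rw [← hπ.1, Measure.map_apply measurable_fst hU.measurableSet] at h
    exact measure_mono_null (fun w hw => hw.1) h
  · rw [← hπ.2, Measure.map_apply measurable_snd hV.measurableSet] at h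
    exact measure_mono_null (fun w hw => hw.2) h

end Couplings

lemma integral_sub_sub_add {α : Type*} [MeasurableSpace α] {m : Measure α} {f g h k : α → ℝ}
    (hf : Integrable f m) (hg : Integrable g m) (hh : Integrable h m) (hk : Integrable k m) :
    ∫ z, (f z - g z - h z + k z) ∂m =
      ∫ z, f z ∂m - ∫ z, g z ∂m - ∫ z, h z ∂m + ∫ z, k z ∂m := by
  rw [← integral_sub hf hg, ← integral_sub (f := fun z => f z - g z) (hf.sub hg) hh,
    ← integral_add (f := fun z => f z - g z - h z) ((hf.sub hg).sub hh) hk]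

/-! ### First variation of the cost -/

section Variation

/-- Near `0` the linear term dominates. The test point is `t = -r L`, with `r` small enough that
both `|t| ≤ 1` and `r Q < 1`; it yields `L ^ 2 * r * (1 - r Q) ≤ 0`. -/
lemma eq_zero_of_forall_linear_add_sq_nonneg {L Q : ℝ}
    (h : ∀ t : ℝ, |t| ≤ 1 → 0 ≤ t * L + t ^ 2 * Q) : L = 0 := by
  have hD : 0 < |Q| + |L| + 1 := by positivity
  set r := (|Q| + |L| + 1)⁻¹ with hr
  have hr0 : 0 < r := inv_pos.2 hD
  have hrD : r * (|Q| + |L| + 1) = 1 := inv_mul_cancel₀ hD.ne'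
  have hL := mul_nonneg hr0.le (abs_nonneg L)
  have hQ := mul_nonneg hr0.le (abs_nonneg Q)
  have hlt : 0 < 1 - r * Q := by
    nlinarith [mul_le_mul_of_nonneg_left (le_abs_self Q) hr0.le]
  have h1 := h (-(r * L)) (by rw [abs_neg, abs_mul, abs_of_pos hr0]; nlinarith)
  have h2 : L ^ 2 * (r * (1 - r * Q)) ≤ 0 := by linarith
  have h3 : L ^ 2 ≤ 0 := nonpos_of_mul_nonpos_left h2 (mul_pos hr0 hlt)
  exact pow_eq_zero_iff two_ne_zero |>.1 (le_antisymm h3 (sq_nonneg L))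

variable {S : Type*} [MeasurableSpace S]

lemma integral_prod_withDensity_one_add {P : Measure S} [IsProbabilityMeasure P]
    {g : S → ℝ} (hg : Measurable g) (hg1 : ∀ z, |g z| ≤ 1) (c : S × S → ℝ) :
    ∫ w, c w ∂((P.withDensity fun z => ENNReal.ofReal (1 + g z)).prod
      (P.withDensity fun z => ENNReal.ofReal (1 + g z))) =
      ∫ w, (1 + g w.1) * (1 + g w.2) * c w ∂(P.prod P) := by
  have hpos : ∀ z, 0 ≤ 1 + g z := fun z => by linarith [(abs_le.1 (hg1 z)).1]
  have hm : Measurable (fun z => ENNReal.ofReal (1 + g z)) := by fun_prop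
  rw [prod_withDensity hm hm, integral_withDensity_eq_integral_toReal_smul (by fun_prop)
    (Filter.Eventually.of_forall fun w => ENNReal.mul_lt_top ENNReal.ofReal_lt_top
      ENNReal.ofReal_lt_top)]
  refine integral_congr_ae (Filter.Eventually.of_forall fun w => ?_)
  simp [ENNReal.toReal_mul, ENNReal.toReal_ofReal (hpos _)]

lemma integral_prod_withDensity_one_add_mul {P : Measure S} [IsProbabilityMeasure P]
    {h : S → ℝ} (hh : Measurable h) (hh1 : ∀ z, |h z| ≤ 1) {c : S × S → ℝ}
    (hc : Integrable c (P.prod P)) {t : ℝ} (ht : |t| ≤ 1) :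
    ∫ w, c w ∂((P.withDensity fun z => ENNReal.ofReal (1 + t * h z)).prod
      (P.withDensity fun z => ENNReal.ofReal (1 + t * h z))) =
      ∫ w, c w ∂(P.prod P) + (t * (∫ w, (h w.1 + h w.2) * c w ∂(P.prod P))
        + t ^ 2 * ∫ w, h w.1 * h w.2 * c w ∂(P.prod P)) := by
  rw [integral_prod_withDensity_one_add (by fun_prop)
    (fun z => by rw [abs_mul]; exact mul_le_one₀ ht (abs_nonneg _) (hh1 z))]
  have h1 : Integrable (fun w : S × S => (h w.1 + h w.2) * c w) (P.prod P) :=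
    hc.bdd_mul (c := 2) (by fun_prop) (Filter.Eventually.of_forall fun w => by
      have := abs_add_le (h w.1) (h w.2)
      rw [Real.norm_eq_abs]
      linarith [hh1 w.1, hh1 w.2])
  have h2 : Integrable (fun w : S × S => h w.1 * h w.2 * c w) (P.prod P) :=
    hc.bdd_mul (c := 1) (by fun_prop) (Filter.Eventually.of_forall fun w => by
      rw [Real.norm_eq_abs, abs_mul]
      exact mul_le_one₀ (hh1 _) (abs_nonneg _) (hh1 _))
  rw [← integral_const_mul, ← integral_const_mul,
    ← integral_add (h1.const_mul _) (h2.const_mul _),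
    ← integral_add (g := fun w => t * ((h w.1 + h w.2) * c w) + t ^ 2 * (h w.1 * h w.2 * c w)) hc
      ((h1.const_mul t).add (h2.const_mul (t ^ 2)))]
  refine integral_congr_ae (Filter.Eventually.of_forall fun w => ?_)
  ring

/-- The symmetrized partial integral represents the first variation. -/
lemma integral_add_mul_eq {P : Measure S} [IsProbabilityMeasure P]
    {h : S → ℝ} (hh : Measurable h) (hh1 : ∀ z, |h z| ≤ 1) {c : S × S → ℝ}
    (hc : Integrable c (P.prod P)) :
    ∫ w, (h w.1 + h w.2) * c w ∂(P.prod P) =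
      ∫ z, h z * ∫ z', (c (z, z') + c (z', z)) ∂P ∂P := by
  have h1 : Integrable (fun w : S × S => h w.1 * c w) (P.prod P) :=
    hc.bdd_mul (c := 1) (hh.comp measurable_fst).aestronglyMeasurable (Filter.Eventually.of_forall fun w => hh1 _)
  have h2 : Integrable (fun w : S × S => h w.2 * c w) (P.prod P) :=
    hc.bdd_mul (c := 1) (hh.comp measurable_snd).aestronglyMeasurable (Filter.Eventually.of_forall fun w => hh1 _)
  have h2s : Integrable (fun w : S × S => h w.1 * c w.swap) (P.prod P) := h2.swap
  simp only [add_mul]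
  rw [integral_add h1 h2, ← integral_prod_swap (fun w : S × S => h w.2 * c w)]
  simp only [Prod.snd_swap]
  rw [← integral_add h1 h2s, integral_prod (fun w : S × S => h w.1 * c w + h w.1 * c w.swap)
    (h1.add h2s)]
  refine integral_congr_ae (Filter.Eventually.of_forall fun z => ?_)
  simp only [Prod.swap_prod_mk, ← mul_add]
  rw [integral_const_mul]

end Variation

/-! ### Additively separable functions -/

section Separable

variable {X Y : Type*} [MeasurableSpace X] [MeasurableSpace Y] {μ : Measure X} {ν : Measure Y}

/-- Measurable rectangles form a generating π-system containing the whole space, so Dynkin induction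
reaches every measurable set. -/
lemma ae_eq_zero_of_forall_setIntegral_prod_eq_zero {f : X × Y → ℝ}
    (hf : Integrable f (μ.prod ν))
    (h : ∀ A B, MeasurableSet A → MeasurableSet B → ∫ z in A ×ˢ B, f z ∂(μ.prod ν) = 0) :
    f =ᵐ[μ.prod ν] 0 := by
  refine hf.ae_eq_zero_of_forall_setIntegral_eq_zero fun s hs hfin => ?_
  clear hfin
  induction s, hs using MeasurableSpace.induction_on_inter generateFrom_prod.symm
    isPiSystem_prod with
  | empty => simp
  | basic t ht =>
    obtain ⟨A, hA, B, hB, rfl⟩ := ht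
    exact h A B hA hB
  | compl t ht ih =>
    have h0 := h Set.univ Set.univ MeasurableSet.univ MeasurableSet.univ
    rw [Set.univ_prod_univ, setIntegral_univ] at h0
    rw [setIntegral_compl ht hf, h0, ih, sub_zero]
  | iUnion s hd hs ih =>
    rw [integral_iUnion hs hd hf.integrableOn]
    simp [ih]

variable [IsProbabilityMeasure μ] [IsProbabilityMeasure ν]

/-- Pairing `F` with the centred product `(1_A - μ A) (1_B - ν B)` gives the integral over `A × B`
of the doubly centred function `F - φ - ψ + I`, which therefore vanishes almost everywhere. -/
lemma isAESeparable_of_forall_integral_mul_eq_zero {F : X × Y → ℝ}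
    (hF : Integrable F (μ.prod ν))
    (h : ∀ g : X × Y → ℝ, Measurable g → (∀ z, |g z| ≤ 1) → (∀ x, ∫ y, g (x, y) ∂ν = 0) →
      (∀ y, ∫ x, g (x, y) ∂μ = 0) → ∫ z, g z * F z ∂(μ.prod ν) = 0) :
    IsAESeparable μ ν F := by
  set I := ∫ z, F z ∂(μ.prod ν) with hI
  set φ : X → ℝ := fun x => ∫ y, F (x, y) ∂ν with hφ
  set ψ : Y → ℝ := fun y => ∫ x, F (x, y) ∂μ with hψ
  have hφi : Integrable φ μ := hF.integral_prod_left
  have hψi : Integrable ψ ν := hF.integral_prod_right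
  have hφi' := hφi.comp_fst ν
  have hψi' := hψi.comp_snd μ
  have key : (fun z => F z - φ z.1 - ψ z.2 + I) =ᵐ[μ.prod ν] 0 := by
    refine ae_eq_zero_of_forall_setIntegral_prod_eq_zero
      (((hF.sub hφi').sub hψi').add (integrable_const I)) fun A B hA hB => ?_
    have hAB := hA.prod hB
    have hAu : MeasurableSet (A ×ˢ (Set.univ : Set Y)) := hA.prod MeasurableSet.univ
    have huB : MeasurableSet ((Set.univ : Set X) ×ˢ B) := MeasurableSet.univ.prod hB
    have e1 : ∫ z in A ×ˢ B, φ z.1 ∂(μ.prod ν) =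
        ν.real B * ∫ z in A ×ˢ Set.univ, F z ∂(μ.prod ν) := by
      rw [setIntegral_prod _ hφi'.integrableOn, setIntegral_prod _ hF.integrableOn]
      simp [integral_const_mul, hφ]
    have e2 : ∫ z in A ×ˢ B, ψ z.2 ∂(μ.prod ν) =
        μ.real A * ∫ z in Set.univ ×ˢ B, F z ∂(μ.prod ν) := by
      rw [setIntegral_prod _ hψi'.integrableOn, ← Measure.prod_restrict,
        integral_prod_symm _ (by rw [Measure.prod_restrict]; exact hF.integrableOn)]
      simp [hψ]
    have e3 : ∫ z in A ×ˢ B, I ∂(μ.prod ν) = μ.real A * ν.real B * I := by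
      simp [measureReal_prod_prod]
    have iBi : Integrable (B.indicator (fun _ => (1 : ℝ))) ν :=
      (integrable_const 1).indicator hB
    have iAi : Integrable (A.indicator (fun _ => (1 : ℝ))) μ :=
      (integrable_const 1).indicator hA
    have bd : ∀ {u a : ℝ}, 0 ≤ u → u ≤ 1 → 0 ≤ a → a ≤ 1 → |u - a| ≤ 1 := by
      intro u a h1 h2 h3 h4
      rw [abs_le]; constructor <;> linarith
    have hg := h (fun z => (A.indicator (fun _ => (1 : ℝ)) z.1 - μ.real A) *
        (B.indicator (fun _ => (1 : ℝ)) z.2 - ν.real B)) ?_ ?_ ?_ ?_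
    · have hpt : ∀ z : X × Y, (A.indicator (fun _ => (1 : ℝ)) z.1 - μ.real A) *
          (B.indicator (fun _ => (1 : ℝ)) z.2 - ν.real B) * F z =
          (A ×ˢ B).indicator F z - ν.real B * (A ×ˢ (Set.univ : Set Y)).indicator F z
            - μ.real A * ((Set.univ : Set X) ×ˢ B).indicator F z
            + μ.real A * ν.real B * F z := by
        intro z
        by_cases h1 : z.1 ∈ A <;> by_cases h2 : z.2 ∈ B <;>
          simp [Set.indicator, Set.mem_prod, h1, h2] <;> ring
      simp only [hpt] at hg
      rw [integral_sub_sub_add (hF.indicator hAB) ((hF.indicator hAu).const_mul _)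
          ((hF.indicator huB).const_mul _) (hF.const_mul _),
        integral_const_mul, integral_const_mul, integral_const_mul,
        integral_indicator hAB, integral_indicator hAu, integral_indicator huB] at hg
      rw [integral_sub_sub_add hF.integrableOn hφi'.integrableOn hψi'.integrableOn
        (integrable_const I).integrableOn, e1, e2, e3]
      exact hg
    · exact (((measurable_const.indicator hA).comp measurable_fst).sub_const _).mul
        (((measurable_const.indicator hB).comp measurable_snd).sub_const _)
    · intro z
      rw [abs_mul]
      refine mul_le_one₀ (bd ?_ ?_ measureReal_nonneg measureReal_le_one) (abs_nonneg _)
        (bd ?_ ?_ measureReal_nonneg measureReal_le_one) <;>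
      · simp only [Set.indicator]; split_ifs <;> norm_num
    · intro x
      dsimp only
      rw [integral_const_mul, integral_sub iBi (integrable_const _), integral_indicator hB]
      simp
    · intro y
      dsimp only
      rw [integral_mul_const, integral_sub iAi (integrable_const _), integral_indicator hA]
      simp
  refine ⟨φ, fun y => ψ y - I, ?_⟩
  filter_upwards [key] with z hz
  simp only [Pi.zero_apply] at hz
  linarith

/-- An almost everywhere separable continuous function has the same integral with respect to
every coupling. -/
lemma IsAESeparable.integral_eq_of_mem_couplings
    [TopologicalSpace X] [SecondCountableTopology X] [BorelSpace X]
    [TopologicalSpace Y] [SecondCountableTopology Y] [BorelSpace Y]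
    {F : X × Y → ℝ} (hF : IsAESeparable μ ν F) (hFc : Continuous F) {M : ℝ}
    (hM : ∀ z, |F z| ≤ M) {π : Measure (X × Y)} (hπ : π ∈ couplings μ ν) :
    ∫ z, F z ∂π = ∫ z, F z ∂(μ.prod ν) := by
  obtain ⟨φ, ψ, hs⟩ := hF
  have hX := Measure.ae_ae_of_ae_prod hs
  have hY : ∀ᵐ y ∂ν, ∀ᵐ x ∂μ, F (x, y) = φ x + ψ y := by
    have h' : ∀ᵐ w ∂(ν.prod μ), F w.swap = φ w.2 + ψ w.1 := by
      rw [← Measure.prod_swap] at hs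
      exact ae_of_ae_map measurable_swap.aemeasurable hs
    exact Measure.ae_ae_of_ae_prod h'
  -- The functions `φ` and `ψ` need not be measurable. Sections of `F` through a generic point `(x₀,
  -- y₀)` replace them by continuous functions.
  obtain ⟨x₀, hx₀⟩ := hX.exists
  obtain ⟨y₀, hy₀, hxy⟩ := (hY.and hx₀).exists
  have hK : ∀ᵐ z ∂(μ.prod ν), F z = F (z.1, y₀) + F (x₀, z.2) - F (x₀, y₀) := by
    filter_upwards [hs, Measure.quasiMeasurePreserving_fst.ae hy₀,
      Measure.quasiMeasurePreserving_snd.ae hx₀] with z h1 h2 h3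
    rw [h1, h2, h3, hxy]
    ring
  -- The identity fails on an open `μ ⊗ ν`-null set, which is null for every coupling.
  have hclosed : IsClosed {z : X × Y | F z = F (z.1, y₀) + F (x₀, z.2) - F (x₀, y₀)} :=
    isClosed_eq hFc (by fun_prop)
  have hfX : Integrable (fun x => F (x, y₀)) μ :=
    Integrable.of_bound (by fun_prop : Continuous fun x => F (x, y₀)).aestronglyMeasurable M
      (Filter.Eventually.of_forall fun x => hM _)
  have hfY : Integrable (fun y => F (x₀, y)) ν :=
    Integrable.of_bound (by fun_prop : Continuous fun y => F (x₀, y)).aestronglyMeasurable M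
      (Filter.Eventually.of_forall fun x => hM _)
  have main : ∀ ρ ∈ couplings μ ν,
      ∫ z, F z ∂ρ = ∫ x, F (x, y₀) ∂μ + ∫ y, F (x₀, y) ∂ν - F (x₀, y₀) := by
    intro ρ hρ
    have := isProbabilityMeasure_of_mem_couplings hρ
    have hae : ∀ᵐ z ∂ρ, F z = F (z.1, y₀) + F (x₀, z.2) - F (x₀, y₀) :=
      measure_eq_zero_of_isOpen_of_mem_couplings hclosed.isOpen_compl hK hρ
    have i1 := integrable_comp_fst_of_mem_couplings hρ hfX
    have i2 := integrable_comp_snd_of_mem_couplings hρ hfY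
    have i12 : Integrable (fun z => F (z.1, y₀) + F (x₀, z.2)) ρ := i1.add i2
    rw [integral_congr_ae hae, integral_sub i12 (integrable_const _), integral_add i1 i2,
      integral_comp_fst_of_mem_couplings hρ hfX.1, integral_comp_snd_of_mem_couplings hρ hfY.1]
    simp
  rw [main π hπ, main _ prod_mem_couplings]

end Separable

/-! ### Positive definite kernels and differences of measures -/

section PositiveDefinite

variable {S : Type*}

/-- Use the `2n` points `s i`, `t i` with weights `1` and `-1`. -/
lemma IsPositiveDefinite.sum_sum_sub_nonneg {k : S × S → ℝ} (hk : IsPositiveDefinite k) (n : ℕ)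
    (s t : Fin n → S) :
    0 ≤ ∑ i, ∑ j, (k (s i, s j) - k (s i, t j) - k (t i, s j) + k (t i, t j)) := by
  have h := hk.2 (n + n) (Fin.append s t) (Fin.append (fun _ => 1) (fun _ => -1))
  simp only [Fin.sum_univ_add, Fin.append_left, Fin.append_right, ← Finset.sum_add_distrib] at h
  refine h.trans_eq (Finset.sum_congr rfl fun i _ => Finset.sum_congr rfl fun j _ => ?_)
  ring

variable [MeasurableSpace S]

/-- Sampling argument: a bounded kernel with nonnegative double sums over finite samples has a
nonnegative double integral. -/
lemma integral_prod_self_nonneg {k : S × S → ℝ} (hk : Measurable k) {M : ℝ}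
    (hM : ∀ w, |k w| ≤ M) (hpos : ∀ (n : ℕ) (s : Fin n → S), 0 ≤ ∑ i, ∑ j, k (s i, s j))
    (ρ : Measure S) [IsProbabilityMeasure ρ] : 0 ≤ ∫ w, k w ∂(ρ.prod ρ) := by
  set I := ∫ w, k w ∂(ρ.prod ρ) with hI
  have hmeas : ∀ (n : ℕ) (i j : Fin n), Measurable fun s : Fin n → S => k (s i, s j) :=
    fun n i j => hk.comp (by fun_prop)
  have hint : ∀ (n : ℕ) (i j : Fin n),
      Integrable (fun s : Fin n → S => k (s i, s j)) (Measure.pi fun _ => ρ) := fun n i j =>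
    Integrable.of_bound (hmeas n i j).aestronglyMeasurable M
      (Filter.Eventually.of_forall fun s => hM _)
  have hoff : ∀ (n : ℕ) (i j : Fin n), i ≠ j →
      ∫ s : Fin n → S, k (s i, s j) ∂(Measure.pi fun _ => ρ) = I := by
    intro n i j hij
    have hind := (ProbabilityTheory.iIndepFun_pi (μ := fun _ : Fin n => ρ)
      (X := fun _ => id) fun _ => aemeasurable_id).indepFun hij
    replace hind := (ProbabilityTheory.indepFun_iff_map_prod_eq_prod_map_map
      (measurable_pi_apply i).aemeasurable (measurable_pi_apply j).aemeasurable).1 hind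
    have e : ∀ l : Fin n, (Measure.pi fun _ : Fin n => ρ).map (fun s => s l) = ρ :=
      fun l => (measurePreserving_eval (fun _ : Fin n => ρ) l).map_eq
    rw [e, e] at hind
    rw [hI, ← hind, integral_map (by fun_prop) hk.aestronglyMeasurable]
  have hdiag : ∀ (n : ℕ) (i : Fin n),
      ∫ s : Fin n → S, k (s i, s i) ∂(Measure.pi fun _ => ρ) ≤ M := by
    intro n i
    have := integral_mono (hint n i i) (integrable_const M)
      (fun s => (abs_le.1 (hM (s i, s i))).2)
    simpa using this
  have hle : ∀ (n : ℕ) (i j : Fin n),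
      ∫ s : Fin n → S, k (s i, s j) ∂(Measure.pi fun _ => ρ) ≤
        I + if i = j then M - I else 0 := by
    intro n i j
    split_ifs with hij
    · subst hij
      linarith [hdiag n i]
    · rw [hoff n i j hij, add_zero]
  -- For an i.i.d. sample of size `n`, the `n (n - 1)` off-diagonal terms have mean `I` and the `n`
  -- diagonal ones at most `M`. If `I < 0`, the bound fails for large `n`.
  have hn : ∀ n : ℕ, 0 ≤ (n : ℝ) * (n * I + (M - I)) := by
    intro n
    have h0 : 0 ≤ ∫ s : Fin n → S, ∑ i, ∑ j, k (s i, s j) ∂(Measure.pi fun _ => ρ) :=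
      integral_nonneg fun s => hpos n s
    rw [integral_finsetSum _ fun i _ => integrable_finsetSum _ fun j _ => hint n i j] at h0
    simp only [integral_finsetSum _ fun j _ => hint n _ j] at h0
    refine h0.trans ((Finset.sum_le_sum fun i _ => Finset.sum_le_sum fun j _ =>
      hle n i j).trans_eq ?_)
    simp [Finset.sum_add_distrib]
    ring
  by_contra hneg
  push Not at hneg
  obtain ⟨n, hnlt⟩ := exists_nat_gt ((M - I) / (-I))
  rw [div_lt_iff₀ (by linarith)] at hnlt
  have hMI : 0 ≤ M - I := by
    obtain ⟨s⟩ : Nonempty S := nonempty_of_isProbabilityMeasure ρ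
    linarith [(abs_nonneg _).trans (hM (s, s))]
  have hn0 : 0 < (n : ℝ) := by
    by_contra h
    have : (n : ℝ) = 0 := le_antisymm (not_lt.1 h) n.cast_nonneg
    rw [this] at hnlt
    linarith
  have := nonneg_of_mul_nonneg_right (hn n) hn0
  linarith

/-- A bounded positive definite kernel is nonnegative on differences of probability measures. -/
lemma IsPositiveDefinite.integral_sub_nonneg {k : S × S → ℝ} (hk : IsPositiveDefinite k)
    (hm : Measurable k) {M : ℝ} (hM : ∀ w, |k w| ≤ M) (π ρ : Measure S)
    [IsProbabilityMeasure π] [IsProbabilityMeasure ρ] :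
    0 ≤ ∫ w, k w ∂(π.prod π) - ∫ w, k w ∂(π.prod ρ) - ∫ w, k w ∂(ρ.prod π)
      + ∫ w, k w ∂(ρ.prod ρ) := by
  set m := (π.prod ρ).prod (π.prod ρ)
  have mk : ∀ {f g : S × S → S} (_ : Measurable f) (_ : Measurable g),
      Measurable fun w : (S × S) × (S × S) => k (f w.1, g w.2) :=
    fun hf hg => hm.comp ((hf.comp measurable_fst).prodMk (hg.comp measurable_snd))
  have hi : ∀ {f g : S × S → S} (_ : Measurable f) (_ : Measurable g),
      Integrable (fun w : (S × S) × (S × S) => k (f w.1, g w.2)) m := fun hf hg =>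
    Integrable.of_bound (mk hf hg).aestronglyMeasurable M
      (Filter.Eventually.of_forall fun w => hM _)
  have hval : ∀ {f g : S × S → S} (_ : Measurable f) (_ : Measurable g),
      ∫ w, k (f w.1, g w.2) ∂m = ∫ w, k w ∂(((π.prod ρ).map f).prod ((π.prod ρ).map g)) := by
    intro f g hf hg
    rw [Measure.map_prod_map _ _ hf hg,
      integral_map (hf.prodMap hg).aemeasurable hm.aestronglyMeasurable]
    rfl
  have m1 : Measurable (Prod.fst : S × S → S) := measurable_fst
  have m2 : Measurable (Prod.snd : S × S → S) := measurable_snd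
  -- Sampling pairs from `π ⊗ ρ` turns the difference `π - ρ` into a single probability measure with
  -- a differenced kernel.
  have h := integral_prod_self_nonneg
    (k := fun w : (S × S) × (S × S) => k (w.1.1, w.2.1) - k (w.1.1, w.2.2) - k (w.1.2, w.2.1)
      + k (w.1.2, w.2.2)) (M := 4 * M)
    ((((mk m1 m1).sub (mk m1 m2)).sub (mk m2 m1)).add (mk m2 m2))
    (fun w => by
      have b1 := abs_le.1 (hM (w.1.1, w.2.1))
      have b2 := abs_le.1 (hM (w.1.1, w.2.2))
      have b3 := abs_le.1 (hM (w.1.2, w.2.1))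
      have b4 := abs_le.1 (hM (w.1.2, w.2.2))
      rw [abs_le]
      constructor <;> linarith)
    (fun n s => hk.sum_sum_sub_nonneg n (fun i => (s i).1) (fun i => (s i).2)) (π.prod ρ)
  rw [integral_sub_sub_add (hi m1 m1) (hi m1 m2) (hi m2 m1) (hi m2 m2),
    hval m1 m1, hval m1 m2, hval m2 m1, hval m2 m2] at h
  simpa using h

end PositiveDefinite

/-! ### The implications between (ii) and (iii) -/

section Main

variable {X Y : Type*} [MeasurableSpace X] [MeasurableSpace Y] {μ : Measure X} {ν : Measure Y}
  [IsProbabilityMeasure μ] [IsProbabilityMeasure ν]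

lemma integrable_symmPartialIntegral {c : (X × Y) × (X × Y) → ℝ}
    (hc : Integrable c ((μ.prod ν).prod (μ.prod ν))) :
    Integrable (symmPartialIntegral μ ν c) (μ.prod ν) :=
  ((hc.add hc.swap).integral_prod_left).const_mul _

lemma isAESeparable_of_isMinimizer_or_isMaximizer {c : (X × Y) × (X × Y) → ℝ}
    (hc : Integrable c ((μ.prod ν).prod (μ.prod ν)))
    (h : IsMinimizer μ ν c (μ.prod ν) ∨ IsMaximizer μ ν c (μ.prod ν)) :
    IsAESeparable μ ν (symmPartialIntegral μ ν c) := by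
  refine isAESeparable_of_forall_integral_mul_eq_zero (integrable_symmPartialIntegral hc)
    fun g hg hg1 hgX hgY => ?_
  have hmem : ∀ t : ℝ, |t| ≤ 1 →
      (μ.prod ν).withDensity (fun z => ENNReal.ofReal (1 + t * g z)) ∈ couplings μ ν :=
    fun t ht => withDensity_mem_couplings (by fun_prop)
      (fun z => by rw [abs_mul]; exact mul_le_one₀ ht (abs_nonneg _) (hg1 z))
      (fun x => by rw [integral_const_mul, hgX, mul_zero])
      (fun y => by rw [integral_const_mul, hgY, mul_zero])
  have hL : ∫ w, (g w.1 + g w.2) * c w ∂((μ.prod ν).prod (μ.prod ν)) = 0 := by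
    rcases h with h | h
    · refine eq_zero_of_forall_linear_add_sq_nonneg
        (Q := ∫ w, g w.1 * g w.2 * c w ∂((μ.prod ν).prod (μ.prod ν))) fun t ht => ?_
      have := h.2 _ (hmem t ht)
      unfold transportCost at this
      rw [integral_prod_withDensity_one_add_mul hg hg1 hc ht] at this
      linarith
    -- A maximizer is handled by negating both coefficients.
    · refine neg_eq_zero.1 (eq_zero_of_forall_linear_add_sq_nonneg
        (Q := -∫ w, g w.1 * g w.2 * c w ∂((μ.prod ν).prod (μ.prod ν))) fun t ht => ?_)
      have := h.2 _ (hmem t ht)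
      unfold transportCost at this
      rw [integral_prod_withDensity_one_add_mul hg hg1 hc ht] at this
      linarith
  rw [integral_add_mul_eq hg hg1 hc] at hL
  calc ∫ z, g z * symmPartialIntegral μ ν c z ∂(μ.prod ν)
      = ∫ z, (1 / 2 : ℝ) * (g z * ∫ z', (c (z, z') + c (z', z)) ∂(μ.prod ν)) ∂(μ.prod ν) := by
        refine integral_congr_ae (Filter.Eventually.of_forall fun z => ?_)
        simp only [symmPartialIntegral]
        ring
    _ = 0 := by rw [integral_const_mul, hL, mul_zero]

lemma integral_symmPartialIntegral {c : (X × Y) × (X × Y) → ℝ} (hm : Measurable c) {M : ℝ}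
    (hM : ∀ w, |c w| ≤ M) (π : Measure (X × Y)) [IsProbabilityMeasure π] :
    ∫ z, symmPartialIntegral μ ν c z ∂π =
      (1 / 2 : ℝ) * (∫ w, c w ∂(π.prod (μ.prod ν)) + ∫ w, c w ∂((μ.prod ν).prod π)) := by
  have h1 : Integrable c (π.prod (μ.prod ν)) :=
    Integrable.of_bound hm.aestronglyMeasurable M (Filter.Eventually.of_forall hM)
  have h2 : Integrable (fun w : (X × Y) × (X × Y) => c w.swap) (π.prod (μ.prod ν)) :=
    Integrable.of_bound (hm.comp measurable_swap).aestronglyMeasurable M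
      (Filter.Eventually.of_forall fun w => hM _)
  unfold symmPartialIntegral
  rw [integral_const_mul, ← integral_prod_swap (μ := μ.prod ν) (ν := π) c,
    ← integral_add h1 h2,
    integral_prod (fun w : (X × Y) × (X × Y) => c w + c w.swap) (h1.add h2)]
  rfl

lemma continuous_symmPartialIntegral
    [TopologicalSpace X] [SecondCountableTopology X] [BorelSpace X]
    [TopologicalSpace Y] [SecondCountableTopology Y] [BorelSpace Y]
    {c : (X × Y) × (X × Y) → ℝ} (hc : Continuous c) {M : ℝ} (hM : ∀ w, |c w| ≤ M) :
    Continuous (symmPartialIntegral μ ν c) := by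
  refine continuous_const.mul (continuous_of_dominated (bound := fun _ => M + M) (fun z => ?_)
    (fun z => Filter.Eventually.of_forall fun z' => ?_) (integrable_const _)
    (Filter.Eventually.of_forall fun z' => by fun_prop))
  · exact (by fun_prop : Continuous fun z' => c (z, z') + c (z', z)).aestronglyMeasurable
  · exact (abs_add_le _ _).trans (add_le_add (hM _) (hM _))

lemma abs_symmPartialIntegral_le {c : (X × Y) × (X × Y) → ℝ} {M : ℝ} (hM : ∀ w, |c w| ≤ M)
    (z : X × Y) : |symmPartialIntegral μ ν c z| ≤ M := by
  have h : ‖∫ z', (c (z, z') + c (z', z)) ∂(μ.prod ν)‖ ≤ (M + M) * (μ.prod ν).real Set.univ :=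
    norm_integral_le_of_norm_le_const (Filter.Eventually.of_forall fun z' =>
      (abs_add_le _ _).trans (add_le_add (hM _) (hM _)))
  rw [probReal_univ, mul_one, Real.norm_eq_abs] at h
  rw [symmPartialIntegral, abs_mul, abs_of_pos (by norm_num : (0 : ℝ) < 1 / 2)]
  linarith

lemma IsPositiveDefinite.isMinimizer_prod
    [TopologicalSpace X] [SecondCountableTopology X] [BorelSpace X]
    [TopologicalSpace Y] [SecondCountableTopology Y] [BorelSpace Y]
    {c : (X × Y) × (X × Y) → ℝ} (hpd : IsPositiveDefinite c) (hc : Continuous c) {M : ℝ}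
    (hM : ∀ w, |c w| ≤ M) (h : IsAESeparable μ ν (symmPartialIntegral μ ν c)) :
    IsMinimizer μ ν c (μ.prod ν) := by
  refine ⟨prod_mem_couplings, fun π hπ => ?_⟩
  have := isProbabilityMeasure_of_mem_couplings hπ
  -- The cross terms in `h1` are those of `2 ∫ c̃ dπ`; by `h2` they total twice the cost of `μ ⊗ ν`.
  have h1 := hpd.integral_sub_nonneg hc.measurable hM π (μ.prod ν)
  have h2 := h.integral_eq_of_mem_couplings (continuous_symmPartialIntegral hc hM)
    (abs_symmPartialIntegral_le hM) hπ
  rw [integral_symmPartialIntegral hc.measurable hM,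
    integral_symmPartialIntegral hc.measurable hM] at h2
  unfold transportCost
  linarith

end Main

end QOT

theorem mainTheorem11 {X Y : Type*}
    [TopologicalSpace X] [PolishSpace X] [MeasurableSpace X] [BorelSpace X]
    [TopologicalSpace Y] [PolishSpace Y] [MeasurableSpace Y] [BorelSpace Y]
    (μ : Measure X) [IsProbabilityMeasure μ] (ν : Measure Y) [IsProbabilityMeasure ν]
    (c : (X × Y) × (X × Y) → ℝ) (hc : Continuous c)
    (cX : X → ℝ) (hcX : Continuous cX) (hcXint : Integrable cX μ)
    (cY : Y → ℝ) (hcY : Continuous cY) (hcYint : Integrable cY ν)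
    (hdom : ∀ x y x' y', |c ((x, y), (x', y'))| ≤ cX x + cY y + cX x' + cY y') :
    -- all the integrals involved converge absolutely
    (∀ π ∈ QOT.couplings μ ν, Integrable c (π.prod π)) ∧
    (∀ z, Integrable (fun z' => c (z, z') + c (z', z)) (μ.prod ν)) ∧
    -- (i) implies (ii)
    ((∀ π ∈ QOT.couplings μ ν, QOT.IsMinimizer μ ν c π) →
      (QOT.IsMinimizer μ ν c (μ.prod ν) ∨ QOT.IsMaximizer μ ν c (μ.prod ν))) ∧
    -- (ii) implies (iii)
    ((QOT.IsMinimizer μ ν c (μ.prod ν) ∨ QOT.IsMaximizer μ ν c (μ.prod ν)) →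
      QOT.IsAESeparable μ ν (QOT.symmPartialIntegral μ ν c)) ∧
    -- bounded positive definite costs
    ((∃ M : ℝ, ∀ z, |c z| ≤ M) → QOT.IsPositiveDefinite c →
      (QOT.IsAESeparable μ ν (QOT.symmPartialIntegral μ ν c) →
        QOT.IsMinimizer μ ν c (μ.prod ν)) ∧
      ((QOT.IsMinimizer μ ν c (μ.prod ν) ∨ QOT.IsMaximizer μ ν c (μ.prod ν)) ↔
        QOT.IsAESeparable μ ν (QOT.symmPartialIntegral μ ν c))) := by
  have hint : ∀ π ∈ QOT.couplings μ ν, Integrable c (π.prod π) := fun π hπ =>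
    QOT.integrable_prod_of_mem_couplings hc.measurable hcXint hcYint hdom hπ hπ
  have hsep := QOT.isAESeparable_of_isMinimizer_or_isMaximizer
    (hint _ QOT.prod_mem_couplings)
  refine ⟨hint, fun z => QOT.integrable_section_add_of_mem_couplings hc.measurable hcXint hcYint
    hdom QOT.prod_mem_couplings z, fun h => Or.inl (h _ QOT.prod_mem_couplings), hsep, ?_⟩
  rintro ⟨M, hM⟩ hpd
  exact ⟨hpd.isMinimizer_prod hc hM, hsep, fun h => Or.inl (hpd.isMinimizer_prod hc hM h)⟩
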